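/- Let $\overline{\mathbb C}=\mathbb C\cup\mathbb C^\infty$, where $\mathbb C^\infty=\{\infty e^{i\theta}:\theta\in\mathbb R\}$ is a circle of points at infinity ($\infty e^{i\theta}=\infty e^{i\theta'}$ if and only if $e^{i\theta}=e^{i\theta'}$). Put $G(z)=\frac{z}{1+|z|}$ for $z\in\mathbb C$ and $G(\infty e^{i\theta})=e^{i\theta}$, and equip $\overline{\mathbb C}$ with the metric $d(z_1,z_2)=|G(z_1)-G(z_2)|$. Let $L\subset\mathbb C$ be a compact set with interior $L^\circ$, and let $z_0\in L^\circ$. Assume that for every boundary point $\zeta\in\partial L$ the segment $[z_0,\zeta]$ satisfies $[z_0,\zeta]\setminus\{\zeta\}\subset L^\circ$. Then a function $f:L\to\overline{\mathbb C}$ is the limit, uniformly on $L$ with respect to $d$, of a sequence of complex polynomials if and only if it is of one of the following two types: (a) (finite type) $f:L\to\overline{\mathbb C}$ is continuous, $f(L^\circ)\subset\mathbb C$, and $f|_{L^\circ}$ is holomorphic; (b) (infinite type) $f$ is continuous, takes values in $\mathbb C^\infty$, and has the form $f(z)=\infty e^{i\theta(z)}$, $z\in L$, for some function $\theta:L\to\mathbb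 R$ that is continuous on $L$ and harmonic in $L^\circ$. -/

import Mathlib

open Filter Topology

/-- The compactification `ℂ ∪ ℂ^∞` of the plane by a circle of points at infinity: a point is
either a complex number or a point at infinity `∞u` in a unimodular direction `u`. -/
inductive CircleCompactification : Type
  | ofComplex (z : ℂ) : CircleCompactification
  | infinity (u : Circle) : CircleCompactification

namespace CircleCompactification

/-- The bijection onto the closed unit disc: `z ↦ z / (1 + |z|)` on `ℂ`, and `∞u ↦ u`. -/
noncomputable def toDisc : CircleCompactification → ℂ
  | ofComplex z => z / ((1 + ‖z‖ : ℝ) : ℂ)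
  | infinity u => (u : ℂ)

theorem norm_toDisc_ofComplex (z : ℂ) : ‖toDisc (ofComplex z)‖ = ‖z‖ / (1 + ‖z‖) := by
  have h : (0 : ℝ) ≤ 1 + ‖z‖ := by positivity
  rw [toDisc, norm_div, Complex.norm_real, Real.norm_of_nonneg h]

theorem norm_toDisc_ofComplex_lt_one (z : ℂ) : ‖toDisc (ofComplex z)‖ < 1 := by
  rw [norm_toDisc_ofComplex, div_lt_one (by positivity)]
  linarith

theorem norm_toDisc_infinity (u : Circle) : ‖toDisc (infinity u)‖ = 1 := by
  exact Circle.norm_coe u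

theorem toDisc_injective : Function.Injective toDisc := by
  rintro (z | u) (w | v) h
  · have hn := congrArg norm h
    rw [norm_toDisc_ofComplex, norm_toDisc_ofComplex,
      div_eq_div_iff (by positivity) (by positivity)] at hn
    have hzw : ‖z‖ = ‖w‖ := by linarith
    have hne : ((1 + ‖w‖ : ℝ) : ℂ) ≠ 0 := by
      exact_mod_cast (by positivity : (1 + ‖w‖ : ℝ) ≠ 0)
    simp only [toDisc] at h
    rw [hzw, div_left_inj' hne] at h
    rw [h]
  · have := norm_toDisc_ofComplex_lt_one z
    rw [h, norm_toDisc_infinity] at this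
    exact absurd this (lt_irrefl _)
  · have := norm_toDisc_ofComplex_lt_one w
    rw [← h, norm_toDisc_infinity] at this
    exact absurd this (lt_irrefl _)
  · exact congrArg infinity (Circle.ext h)

/-- The metric `d(x, y) = |toDisc x - toDisc y|`, induced by the Euclidean metric of the closed
unit disc. -/
noncomputable instance : MetricSpace CircleCompactification :=
  MetricSpace.induced toDisc toDisc_injective inferInstance

theorem dist_eq (x y : CircleCompactification) : dist x y = ‖toDisc x - toDisc y‖ :=
  dist_eq_norm (toDisc x) (toDisc y)

/-- `f : L → ℂ ∪ ℂ^∞` is a uniform limit on `L` of (complex) polynomials, for the metric `d`. -/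
def IsUniformLimitOfPolynomials (L : Set ℂ) (f : L → CircleCompactification) : Prop :=
  ∃ P : ℕ → Polynomial ℂ,
    TendstoUniformly (fun (n : ℕ) (z : L) => ofComplex ((P n).eval (z : ℂ))) f atTop

/-- Finite type: `f` is continuous on `L`, and on the interior of `L` it takes values in `ℂ` and is
holomorphic. -/
def IsFiniteType (L : Set ℂ) (f : L → CircleCompactification) : Prop :=
  Continuous f ∧
    ∃ g : ℂ → ℂ, DifferentiableOn ℂ g (interior L) ∧
      ∀ z : L, (z : ℂ) ∈ interior L → f z = ofComplex (g z)

/-- Infinite type: `f` is continuous and `f(z) = ∞e^{iθ(z)}` on `L`, with `θ` real-valued,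
continuous on `L` and harmonic in the interior of `L`. -/
def IsInfiniteType (L : Set ℂ) (f : L → CircleCompactification) : Prop :=
  Continuous f ∧
    ∃ θ : ℂ → ℝ, ContinuousOn θ L ∧ InnerProductSpace.HarmonicOnNhd θ (interior L) ∧
      ∀ z : L, f z = infinity (Circle.exp (θ z))

end CircleCompactification

/-!
For sufficiency, the contractions `z ↦ z₀ + s (z - z₀)`, `s < 1`, map `L` into its interior,
so it suffices to approximate functions that are of finite or infinite type near `L`. If `g` is
holomorphic near `L`, then `t ↦ g (z₀ + t (z - z₀))` is an analytic function, defined near `[0, 1]`,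
with values in the Banach space `C(L, ℂ)`. For small `t` its values lie in the closure of the
polynomials, by Taylor expansion at `z₀`, and by analytic continuation so does its value `g` at
`t = 1`. Applied to the complex gradient, this shows that a function `θ` harmonic near `L` is a
uniform limit of imaginary parts of polynomials `Q`. The entire functions `exp (Q + n)` tend to
`∞e^{i Im Q}`, and they are themselves limits of polynomials.

For necessity, let `F` be the limit of the polynomials `P n`. Near a point where `F`
is infinite, the reciprocals `1 / P n` converge to a holomorphic function which, after a rotation,
has nonnegative real part and a zero, and so vanishes identically. By connectedness `F` is either
finite on the whole interior, and then holomorphic, or infinite on all of `L`. In the latter case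
`F = ∞e^{iθ}` for a continuous `θ` since `L` is contractible, and `θ` is harmonic because it is,
locally and up to a constant, the limit of the arguments of the polynomials `P n`.
-/

section StrictStarConvex

variable {E : Type*} [NormedAddCommGroup E] [NormedSpace ℝ E] {c : E} {s : Set E}

/-- `s` is strictly star-convex at `c`: each open segment from `c` to a point of `s` lies in the
interior of `s`. The centre `c` is itself required to be interior as soon as `s` is nonempty. -/
def StrictStarConvex (c : E) (s : Set E) : Prop :=
  ∀ ⦃z⦄, z ∈ s → ∀ ⦃t : ℝ⦄, t ∈ Set.Ico 0 1 → c + t • (z - c) ∈ interior s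

namespace StrictStarConvex

theorem starConvex (h : StrictStarConvex c s) : StarConvex ℝ c s := by
  rw [starConvex_iff_segment_subset]
  intro z hz
  rw [segment_eq_image']
  rintro _ ⟨t, ⟨ht₀, ht₁⟩, rfl⟩
  rcases ht₁.lt_or_eq with ht₁ | rfl
  · exact interior_subset (h hz ⟨ht₀, ht₁⟩)
  · simpa using hz

theorem interior (h : StrictStarConvex c s) : StrictStarConvex c (interior s) := by
  intro z hz t ht
  simpa only [interior_interior] using h (interior_subset hz) ht

theorem subset_closure_interior (h : StrictStarConvex c s) : s ⊆ closure (_root_.interior s) := by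
  intro z hz
  have hlim : Tendsto (fun t : ℝ => c + t • (z - c)) (𝓝[<] 1) (𝓝 z) := by
    have hcont : Continuous fun t : ℝ => c + t • (z - c) := by fun_prop
    simpa using (hcont.tendsto 1).mono_left nhdsWithin_le_nhds
  exact mem_closure_of_tendsto hlim
    (Eventually.mono (Ico_mem_nhdsLT one_pos) fun t ht => h hz ht)

end StrictStarConvex

theorem nonempty_inter_frontier_of_isPreconnected {X : Type*} [TopologicalSpace X] {t u : Set X}
    (ht : IsPreconnected t) (hu : (t ∩ u).Nonempty) (huc : (t ∩ uᶜ).Nonempty) :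
    (t ∩ frontier u).Nonempty := by
  by_contra hdisj
  have hfr : ∀ z ∈ t, z ∈ closure u → z ∈ interior u := fun z hz hzu =>
    by_contra fun hzi => hdisj ⟨z, hz, hzu, hzi⟩
  obtain ⟨z, -, hzi, hzc⟩ := ht (interior u) (closure u)ᶜ isOpen_interior
    isClosed_closure.isOpen_compl (fun z hzt => (em (z ∈ closure u)).imp_left (hfr z hzt))
    (hu.imp fun z hz => ⟨hz.1, hfr z hz.1 (subset_closure hz.2)⟩)
    (huc.imp fun z hz => ⟨hz.1, fun hzu => hz.2 (interior_subset (hfr z hz.1 hzu))⟩)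
  exact hzc (interior_subset_closure hzi)

theorem exists_one_le_add_smul_mem_frontier (hs : Bornology.IsBounded s) {v : E} (hv : v ≠ 0)
    (hcv : c + v ∈ s) : ∃ a : ℝ, 1 ≤ a ∧ c + a • v ∈ frontier s := by
  have hray : IsPreconnected ((fun a : ℝ => c + a • v) '' Set.Ici 1) :=
    isPreconnected_Ici.image _ (by fun_prop)
  obtain ⟨a, ha, has⟩ : ∃ a : ℝ, 1 ≤ a ∧ c + a • v ∉ s := by
    have hunb : Tendsto (fun a : ℝ => c + a • v) atTop (Bornology.cobounded E) := by
      refine tendsto_norm_atTop_iff_cobounded.1 (tendsto_atTop_mono (fun a => ?_)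
        (tendsto_atTop_add_const_left _ (-‖c‖)
          (tendsto_id.atTop_mul_const (norm_pos_iff.2 hv))))
      have hav : a * ‖v‖ ≤ ‖a • v‖ := by
        rw [norm_smul]
        gcongr
        exact Real.le_norm_self a
      have hsub : ‖a • v‖ ≤ ‖c + a • v‖ + ‖c‖ := by
        simpa using norm_sub_le (c + a • v) c
      dsimp only [id]
      linarith
    exact ((eventually_ge_atTop 1).and (hunb.eventually hs)).exists
  obtain ⟨_, ⟨a, ha, rfl⟩, haf⟩ := nonempty_inter_frontier_of_isPreconnected hray
    ⟨c + v, ⟨1, Set.self_mem_Ici, by simp⟩, hcv⟩ ⟨_, ⟨a, ha, rfl⟩, has⟩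
  exact ⟨a, ha, haf⟩

theorem strictStarConvex_of_frontier (hs : Bornology.IsBounded s) (hc : c ∈ interior s)
    (hfr : ∀ ζ ∈ frontier s, segment ℝ c ζ \ {ζ} ⊆ interior s) : StrictStarConvex c s := by
  rintro z hz t ⟨ht₀, ht₁⟩
  rcases eq_or_ne z c with rfl | hzc
  · simpa using hc
  obtain ⟨a, ha, haf⟩ := exists_one_le_add_smul_mem_frontier (c := c) hs (sub_ne_zero.2 hzc)
    (by simpa using hz)
  have ha₀ : 0 < a := one_pos.trans_le ha
  refine hfr _ haf ⟨?_, ?_⟩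
  · rw [segment_eq_image']
    refine ⟨t / a, ⟨by positivity, (div_le_one ha₀).2 (ht₁.le.trans ha)⟩, ?_⟩
    simp [smul_smul, div_mul_cancel₀ t ha₀.ne']
  · simpa [sub_ne_zero.2 hzc] using (ht₁.trans_le ha).ne

end StrictStarConvex

section ContinuousLift

theorem exists_continuousMap_lift {E X A : Type*} [TopologicalSpace E] [TopologicalSpace X]
    [TopologicalSpace A] [ContractibleSpace A] {p : C(E, X)} (hp : IsCoveringMap p)
    (hsurj : Function.Surjective p) (f : C(A, X)) : ∃ g : C(A, E), p.comp g = f := by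
  obtain ⟨a, ⟨H⟩⟩ := id_nullhomotopic A
  obtain ⟨e, he⟩ := hsurj (f a)
  let H' : C(unitInterval × A, X) := f.comp H.symm.toContinuousMap
  have hH' : ∀ x, H' (0, x) = p (ContinuousMap.const A e x) := fun x => by
    simp [H', he]
  refine ⟨(hp.liftHomotopy H' _ hH').comp (ContinuousMap.prodMk (.const A 1) (.id A)), ?_⟩
  ext x
  exact (congrFun (hp.liftHomotopy_lifts H' _ hH') (1, x)).trans (by simp [H'])

end ContinuousLift

section Holomorphic

variable {E : Type*} [NormedAddCommGroup E] [NormedSpace ℂ E]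

theorem analyticOnNhd_of_forall_differentiableOn_clm_comp [CompleteSpace E] {ι : Type*}
    {ℓ : ι → E →L[ℂ] ℂ} (hℓ : ∀ ⦃x y⦄, (∀ i, ℓ i x = ℓ i y) → x = y) {F : ℂ → E} {T : Set ℂ}
    (hT : IsOpen T) (hF : ContinuousOn F T) (hd : ∀ i, DifferentiableOn ℂ (fun t => ℓ i (F t)) T) :
    AnalyticOnNhd ℂ F T := by
  intro t₀ ht₀
  obtain ⟨R, hR, hRT⟩ := Metric.nhds_basis_closedBall.mem_iff.1 (hT.mem_nhds ht₀)
  lift R to NNReal using hR.le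
  have hFs : ContinuousOn F (Metric.sphere t₀ R) :=
    (hF.mono hRT).mono Metric.sphere_subset_closedBall
  have hps := hasFPowerSeriesOn_cauchy_integral (hFs.circleIntegrable R.2) (by exact_mod_cast hR)
  refine (hps.congr fun w hw => hℓ fun i => ?_).analyticAt
  rw [Metric.eball_coe] at hw
  have hint : CircleIntegrable (fun s => (s - w)⁻¹ • F s) t₀ R := by
    refine ContinuousOn.circleIntegrable R.2 (ContinuousOn.fun_smul ?_ hFs)
    exact ContinuousOn.inv₀ (by fun_prop) fun s hs =>
      sub_ne_zero.2 (ne_of_mem_of_not_mem hs fun hws => (Metric.mem_ball.1 hw).ne hws)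
  have hcomm : ℓ i (∮ s in C(t₀, R), (s - w)⁻¹ • F s) =
      ∮ s in C(t₀, R), (s - w)⁻¹ • ℓ i (F s) := by
    simpa [circleIntegral] using ((ℓ i).intervalIntegral_comp_comm hint.out).symm
  rw [map_smul, hcomm, ((hd i).mono hRT).circleIntegral_sub_inv_smul hw, smul_smul,
    inv_mul_cancel₀ Complex.two_pi_I_ne_zero, one_smul]

theorem mem_submodule_of_analyticOnNhd_of_isPreconnected {S : Submodule ℂ E}
    (hS : IsClosed (S : Set E)) {F : ℂ → E} {U : Set ℂ} (hF : AnalyticOnNhd ℂ F U)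
    (hU : IsPreconnected U) {t₀ : ℂ} (ht₀ : t₀ ∈ U)
    (h : ∀ᶠ t in 𝓝 t₀, F t ∈ S) {t : ℂ} (ht : t ∈ U) : F t ∈ S := by
  have : IsClosed (S : Set E) := hS
  have hquot : AnalyticOnNhd ℂ (fun t => S.mkQL (F t)) U := fun x hx =>
    (S.mkQL.analyticAt _).comp (hF x hx)
  simpa using hquot.eqOn_zero_of_preconnected_of_eventuallyEq_zero hU ht₀
    (by filter_upwards [h] with t ht; simpa using ht) ht

theorem exists_analyticOnNhd_continuousMap {K : Type*} [TopologicalSpace K] [CompactSpace K]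
    {T : Set ℂ} (hT : IsOpen T) {G : ℂ → K → ℂ}
    (hG : ContinuousOn (Function.uncurry G) (T ×ˢ .univ))
    (hd : ∀ z, DifferentiableOn ℂ (fun t => G t z) T) :
    ∃ F : ℂ → C(K, ℂ), AnalyticOnNhd ℂ F T ∧ ∀ t ∈ T, ∀ z, F t z = G t z := by
  let Φ : C(T, C(K, ℂ)) := ContinuousMap.curry
    ⟨fun p : T × K => G p.1 p.2, hG.comp_continuous (f := fun p : T × K => ((p.1 : ℂ), p.2))
      (by fun_prop) fun p => ⟨p.1.2, trivial⟩⟩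
  let F : ℂ → C(K, ℂ) := Function.extend Subtype.val Φ 0
  have hF : ∀ t : T, F t = Φ t := Subtype.val_injective.extend_apply Φ 0
  have hFG : ∀ t ∈ T, ∀ z, F t z = G t z := fun t ht z =>
    DFunLike.congr_fun (hF ⟨t, ht⟩) z
  refine ⟨F, analyticOnNhd_of_forall_differentiableOn_clm_comp
    (ℓ := fun z : K => ContinuousMap.evalCLM ℂ z) (fun _ _ h => ContinuousMap.ext h) hT ?_
    fun z => (hd z).congr fun t ht => hFG t ht z, hFG⟩
  exact continuousOn_iff_continuous_domRestrict.2 (Φ.continuous.congr fun t => (hF t).symm)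

end Holomorphic

section Runge

variable {K U : Set ℂ}

theorem isOpen_setOf_forall_add_mul_sub_mem (hK : IsCompact K) (hU : IsOpen U) (c : ℂ) :
    IsOpen {t : ℂ | ∀ z ∈ K, c + t * (z - c) ∈ U} := by
  refine isOpen_iff_eventually.2 fun t ht =>
    hK.eventually_forall_of_forall_eventually fun z hz => ?_
  have hcont : Continuous fun p : ℂ × ℂ => c + p.1 * (p.2 - c) := by fun_prop
  exact hcont.continuousAt.eventually_mem (hU.mem_nhds (ht z hz))

variable [CompactSpace K]

theorem mem_closure_polynomialFunctions_of_differentiableOn_closedBall {c : ℂ} {r s : NNReal}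
    (hsr : s < r) (hK : K ⊆ Metric.ball c s) {g : ℂ → ℂ}
    (hg : DifferentiableOn ℂ g (Metric.closedBall c r)) {G : C(K, ℂ)} (hG : ∀ z : K, G z = g z) :
    G ∈ (polynomialFunctions K).topologicalClosure := by
  have hlim := (hg.hasFPowerSeriesOnBall (pos_of_gt hsr)).tendstoUniformlyOn'
    (ENNReal.coe_lt_coe.2 hsr)
  let P : ℕ → Polynomial ℂ := fun n => ∑ k ∈ Finset.range n,
    Polynomial.C ((cauchyPowerSeries g c r).coeff k) * (Polynomial.X - Polynomial.C c) ^ k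
  have hP : ∀ n z, (cauchyPowerSeries g c r).partialSum n (z - c) = (P n).eval z := fun n z => by
    simp [P, FormalMultilinearSeries.partialSum, Polynomial.eval_finsetSum, mul_comm]
  have hPG : Tendsto (fun n => (P n).toContinuousMapOn K) atTop (𝓝 G) := by
    simp only [hP] at hlim
    rw [ContinuousMap.tendsto_iff_tendstoUniformly, funext hG]
    exact tendstoUniformlyOn_iff_tendstoUniformly_comp_coe.1 (hlim.mono hK)
  exact mem_closure_of_tendsto hPG (Eventually.of_forall fun n => ⟨P n, trivial, rfl⟩)

theorem mem_closure_polynomialFunctions_of_starConvex {z₀ : ℂ} (hK : StarConvex ℝ z₀ K)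
    (hz₀ : z₀ ∈ K) (hU : IsOpen U) (hKU : K ⊆ U) {g : ℂ → ℂ} (hg : DifferentiableOn ℂ g U)
    {G : C(K, ℂ)} (hG : ∀ z : K, G z = g z) :
    G ∈ (polynomialFunctions K).topologicalClosure := by
  have hKc : IsCompact K := isCompact_iff_compactSpace.2 ‹_›
  let T : Set ℂ := {t | ∀ z ∈ K, z₀ + t * (z - z₀) ∈ U}
  have hT : IsOpen T := isOpen_setOf_forall_add_mul_sub_mem hKc hU z₀
  have hcont : ContinuousOn (fun p : ℂ × K => g (z₀ + p.1 * (p.2 - z₀))) (T ×ˢ .univ) :=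
    hg.continuousOn.comp (by fun_prop) fun p hp => hp.1 p.2 p.2.2
  obtain ⟨F, hF, hFg⟩ := exists_analyticOnNhd_continuousMap hT
    (G := fun t (z : K) => g (z₀ + t * (z - z₀))) hcont
    fun z => hg.comp (by fun_prop) fun t ht => ht z z.2
  have hIT : (fun t : ℝ => (t : ℂ)) '' Set.Icc 0 1 ⊆ T := by
    rintro _ ⟨t, ht, rfl⟩ z hz
    simpa using hKU (hK.add_smul_sub_mem hz ht.1 ht.2)
  have hI : IsPreconnected ((fun t : ℝ => (t : ℂ)) '' Set.Icc 0 1) :=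
    isPreconnected_Icc.image _ Complex.continuous_ofReal.continuousOn
  have hnear : ∀ᶠ t in 𝓝 (0 : ℂ), F t ∈ (polynomialFunctions K).topologicalClosure := by
    obtain ⟨s, hs⟩ := hKc.isBounded.subset_ball_lt 0 z₀
    lift s to NNReal using hs.1.le
    filter_upwards [(isOpen_setOf_forall_add_mul_sub_mem (isCompact_closedBall z₀ (s + 1 : NNReal))
      hU z₀).mem_nhds (by simpa using fun _ _ => hKU hz₀), hT.mem_nhds (hIT ⟨0, by simp, by simp⟩)]
      with t htU htT
    exact mem_closure_polynomialFunctions_of_differentiableOn_closedBall (lt_add_one s) hs.2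
      (hg.comp (by fun_prop) htU) (hFg t htT)
  have hF₁ : F 1 ∈ (polynomialFunctions K).topologicalClosure :=
    mem_submodule_of_analyticOnNhd_of_isPreconnected
      (S := Subalgebra.toSubmodule (polynomialFunctions K).topologicalClosure)
      (Subalgebra.isClosed_topologicalClosure _) (hF.mono hIT) hI ⟨0, by simp, by simp⟩ hnear
      ⟨1, by simp, by simp⟩
  convert hF₁
  ext z
  rw [hG, hFg 1 (hIT ⟨1, by simp, by simp⟩)]
  simp

end Runge

section HarmonicApproximation

theorem surjective_polynomial_derivative (k : Type*) [Field k] [CharZero k] :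
    Function.Surjective (Polynomial.derivative (R := k)) := by
  intro P
  induction P using Polynomial.induction_on' with
  | add p q hp hq =>
    obtain ⟨⟨p', rfl⟩, ⟨q', rfl⟩⟩ := hp, hq
    exact ⟨p' + q', Polynomial.derivative_add⟩
  | monomial n a =>
    refine ⟨Polynomial.monomial (n + 1) (a / (n + 1 : ℕ)), ?_⟩
    rw [Polynomial.derivative_monomial, Nat.add_sub_cancel,
      div_mul_cancel₀ _ (Nat.cast_ne_zero.2 n.succ_ne_zero)]

theorem exists_polynomial_derivative_eq_eval_eq {k : Type*} [Field k] [CharZero k]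
    (P : Polynomial k) (c a : k) : ∃ Q : Polynomial k, Q.derivative = P ∧ Q.eval c = a := by
  obtain ⟨Q, rfl⟩ := surjective_polynomial_derivative k P
  exact ⟨Q + .C (a - Q.eval c), by simp, by simp⟩

theorem norm_image_sub_le_of_starConvex {E F : Type*} [NormedAddCommGroup E] [NormedSpace ℝ E]
    [NormedAddCommGroup F] [NormedSpace ℝ F] {s : Set E} {c z : E} (hs : StarConvex ℝ c s)
    {f : E → F} {f' : E → E →L[ℝ] F} {C : ℝ} (hf : ∀ x ∈ s, HasFDerivWithinAt f (f' x) s x)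
    (hC : ∀ x ∈ s, ‖f' x‖ ≤ C) (hz : z ∈ s) : ‖f z - f c‖ ≤ C * ‖z - c‖ := by
  have hsub : segment ℝ c z ⊆ s := hs.segment_subset hz
  exact (convex_segment c z).norm_image_sub_le_of_norm_hasFDerivWithin_le
    (fun x hx => (hf x (hsub hx)).mono hsub) (fun x hx => hC x (hsub hx))
    (left_mem_segment ℝ c z) (right_mem_segment ℝ c z)

/-- The complex number `∂θ/∂x - i ∂θ/∂y`: where `θ` is locally the real part of a holomorphic
function, this is the derivative of that function. -/
noncomputable def complexGradient (θ : ℂ → ℝ) (z : ℂ) : ℂ :=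
  fderiv ℝ θ z 1 - Complex.I * fderiv ℝ θ z Complex.I

theorem hasFDerivAt_complexGradient {θ : ℂ → ℝ} {z : ℂ} (hθ : DifferentiableAt ℝ θ z) :
    HasFDerivAt θ (Complex.reCLM ∘L ContinuousLinearMap.mul ℝ ℂ (complexGradient θ z)) z := by
  refine hθ.hasFDerivAt.congr_fderiv (ContinuousLinearMap.ext fun v => ?_)
  have hv : v = v.re • (1 : ℂ) + v.im • Complex.I := by apply Complex.ext <;> simp
  conv_lhs => rw [hv, map_add, map_smul, map_smul]
  simp [complexGradient, mul_comm]

theorem hasFDerivAt_re_polynomial_eval (Q : Polynomial ℂ) (z : ℂ) :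
    HasFDerivAt (fun w => (Q.eval w).re)
      (Complex.reCLM ∘L ContinuousLinearMap.mul ℝ ℂ (Q.derivative.eval z)) z := by
  refine Complex.reCLM.hasFDerivAt.comp z
    (((Q.hasDerivAt z).hasFDerivAt.restrictScalars ℝ).congr_fderiv ?_)
  ext v
  simp [mul_comm]

theorem norm_reCLM_comp_mul_le (w : ℂ) :
    ‖Complex.reCLM ∘L ContinuousLinearMap.mul ℝ ℂ w‖ ≤ ‖w‖ :=
  ContinuousLinearMap.opNorm_le_bound _ (norm_nonneg w) fun v =>
    (Complex.abs_re_le_norm (w * v)).trans (norm_mul_le w v)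

theorem abs_re_polynomial_eval_sub_le_of_starConvex {K : Set ℂ} {c z : ℂ} (hK : StarConvex ℝ c K)
    {θ : ℂ → ℝ} (hθ : ∀ w ∈ K, DifferentiableAt ℝ θ w) {Q : Polynomial ℂ} (hQ : Q.eval c = θ c)
    {C : ℝ} (hC : ∀ w ∈ K, ‖Q.derivative.eval w - complexGradient θ w‖ ≤ C) (hz : z ∈ K) :
    |(Q.eval z).re - θ z| ≤ C * ‖z - c‖ := by
  have hderiv : ∀ w ∈ K, HasFDerivWithinAt (fun w => (Q.eval w).re - θ w)
      (Complex.reCLM ∘L ContinuousLinearMap.mul ℝ ℂ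
        (Q.derivative.eval w - complexGradient θ w)) K w := by
    intro w hw
    rw [map_sub, ContinuousLinearMap.comp_sub]
    exact ((hasFDerivAt_re_polynomial_eval Q w).sub
      (hasFDerivAt_complexGradient (hθ w hw))).hasFDerivWithinAt
  simpa [hQ] using norm_image_sub_le_of_starConvex hK hderiv
    (fun w hw => (norm_reCLM_comp_mul_le _).trans (hC w hw)) hz

theorem mem_closure_range_im_polynomial_of_starConvex {K U : Set ℂ} [CompactSpace K] {z₀ : ℂ}
    (hK : StarConvex ℝ z₀ K) (hz₀ : z₀ ∈ K) (hU : IsOpen U) (hKU : K ⊆ U) {θ : ℂ → ℝ}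
    (hθ : InnerProductSpace.HarmonicOnNhd θ U) {Θ : C(K, ℝ)} (hΘ : ∀ z : K, Θ z = θ z) :
    Θ ∈ closure (Set.range fun Q : Polynomial ℂ =>
      (Complex.imCLM : C(ℂ, ℝ)).comp (Q.toContinuousMapOn K)) := by
  have hgrad : DifferentiableOn ℂ (complexGradient θ) U := fun z hz =>
    (HarmonicAt.differentiableAt_complex_partial (hθ z hz)).differentiableWithinAt
  have hgradK := mem_closure_polynomialFunctions_of_starConvex hK hz₀ hU hKU hgrad
    (G := ⟨_, hgrad.continuousOn.comp_continuous continuous_subtype_val fun z => hKU z.2⟩)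
    fun _ => rfl
  obtain ⟨r, hr, hKr⟩ := (isCompact_iff_compactSpace.2 ‹_›).isBounded.subset_ball_lt 0 z₀
  refine Metric.mem_closure_iff.2 fun ε hε => ?_
  obtain ⟨_, ⟨P, -, rfl⟩, hP⟩ := Metric.mem_closure_iff.1 hgradK (ε / r) (by positivity)
  rw [dist_comm, ContinuousMap.dist_lt_iff (by positivity)] at hP
  obtain ⟨Q, rfl, hQ₀⟩ := exists_polynomial_derivative_eq_eval_eq P z₀ (θ z₀)
  refine ⟨_, ⟨.C Complex.I * Q, rfl⟩, ?_⟩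
  rw [dist_comm, ContinuousMap.dist_lt_iff hε]
  intro z
  have hQ : |(Q.eval (z : ℂ)).re - θ z| ≤ ε / r * ‖(z : ℂ) - z₀‖ :=
    abs_re_polynomial_eval_sub_le_of_starConvex hK
      (fun w hw => (hθ w (hKU hw)).1.differentiableAt (by norm_num)) hQ₀
      (fun w hw => by simpa [dist_eq_norm] using (hP ⟨w, hw⟩).le) z.2
  calc dist _ _ = |(Q.eval (z : ℂ)).re - θ z| := by simp [hΘ, Real.dist_eq]
    _ ≤ ε / r * ‖(z : ℂ) - z₀‖ := hQ
    _ < ε / r * r := by gcongr; exact mem_ball_iff_norm.1 (hKr z.2)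
    _ = ε := div_mul_cancel₀ ε hr.ne'

end HarmonicApproximation

section HarmonicLimits

open InnerProductSpace Metric

theorem harmonicAt_comp_of_analyticAt {θ : ℂ → ℝ} {φ : ℂ → ℂ} {z : ℂ} (hθ : HarmonicAt θ (φ z))
    (hφ : AnalyticAt ℂ φ z) : HarmonicAt (fun w => θ (φ w)) z := by
  obtain ⟨ε, hε, hball⟩ := Metric.isOpen_iff.1 (isOpen_setOfPred_harmonicAt θ) _ hθ
  obtain ⟨F, hF, hFθ⟩ := HarmonicOnNhd.exists_analyticOnNhd_ball_re_eq fun _ hy => hball hy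
  refine (harmonicAt_congr_nhds ?_).1 ((hF _ (mem_ball_self hε)).comp hφ).harmonicAt_re
  filter_upwards [hφ.continuousAt.preimage_mem_nhds (ball_mem_nhds _ hε)] with w hw
  exact hFθ hw

theorem norm_sub_le_of_re_sub_le {f : ℂ → ℂ} {c z : ℂ} {R M : ℝ} (hM : 0 < M)
    (hf : DifferentiableOn ℂ f (ball c R)) (hre : ∀ w ∈ ball c R, (f w - f c).re ≤ M)
    (hz : z ∈ ball c (R / 2)) : ‖f z - f c‖ ≤ 2 * M := by
  have hzR : ‖z - c‖ < R / 2 := mem_ball_iff_norm.1 hz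
  have hR : 0 < R := by linarith [norm_nonneg (z - c)]
  have hmaps : Set.MapsTo (c + ·) (ball 0 R) (ball c R) := fun w hw => by
    simpa [mem_ball_iff_norm] using hw
  have hbound := Complex.borelCaratheodory_zero (f := fun w => f (c + w) - f c) (z := z - c) hM
    ((hf.comp (by fun_prop) hmaps).sub_const _) (fun w hw => hre _ (hmaps hw)) hR
    (by rw [mem_ball_zero_iff]; linarith) (by simp)
  rw [add_sub_cancel] at hbound
  refine hbound.trans ((div_le_iff₀ (by linarith)).2 ?_)
  gcongr
  linarith

theorem uniformCauchySeqOn_sub_of_re {F : ℕ → ℂ → ℂ} {c : ℂ} {R : ℝ}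
    (hF : ∀ᶠ n in atTop, DifferentiableOn ℂ (F n) (ball c R))
    (hre : UniformCauchySeqOn (fun n z => (F n z).re) atTop (ball c R)) :
    UniformCauchySeqOn (fun n z => F n z - F n c) atTop (ball c (R / 2)) := by
  refine Metric.uniformCauchySeqOn_iff.2 fun ε hε => ?_
  obtain ⟨N₁, hN₁⟩ := Metric.uniformCauchySeqOn_iff.1 hre (ε / 5) (by positivity)
  obtain ⟨N₂, hN₂⟩ := eventually_atTop.1 hF
  refine ⟨max N₁ N₂, fun m hm n hn z hz => ?_⟩
  have hR : c ∈ ball c R := mem_ball_self (by linarith [pos_of_mem_ball hz])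
  have hdist := hN₁ m (le_of_max_le_left hm) n (le_of_max_le_left hn)
  have hbound := norm_sub_le_of_re_sub_le (f := fun w => F m w - F n w) (M := 2 * (ε / 5))
    (by positivity) ((hN₂ m (le_of_max_le_right hm)).sub (hN₂ n (le_of_max_le_right hn)))
    (fun w hw => ?_) hz
  · rw [dist_eq_norm, sub_sub_sub_comm]
    linarith
  · have hw' := (abs_lt.1 (hdist w hw)).2
    have hc' := (abs_lt.1 (hdist c hR)).1
    simp only [Complex.sub_re]
    linarith

theorem harmonicAt_of_tendstoUniformlyOn_ball {h : ℕ → ℂ → ℝ} {β : ℂ → ℝ} {c : ℂ} {R : ℝ}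
    (hR : 0 < R) (hh : ∀ᶠ n in atTop, HarmonicOnNhd (h n) (ball c R))
    (hβ : TendstoUniformlyOn h β atTop (ball c R)) : HarmonicAt β c := by
  choose! F hFa hFh using fun n (hn : HarmonicOnNhd (h n) (ball c R)) =>
    hn.exists_analyticOnNhd_ball_re_eq
  have hFd : ∀ᶠ n in atTop, DifferentiableOn ℂ (F n) (ball c R) :=
    hh.mono fun n hn => (hFa n hn).differentiableOn
  have hFβ : TendstoUniformlyOn (fun n z => (F n z).re) β atTop (ball c R) :=
    hβ.congr (hh.mono fun n hn z hz => (hFh n hn hz).symm)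
  have hcauchy := uniformCauchySeqOn_sub_of_re hFd hFβ.uniformCauchySeqOn
  choose! G hG using fun z (hz : z ∈ ball c (R / 2)) =>
    cauchySeq_tendsto_of_complete (hcauchy.cauchySeq hz)
  have hsub : ball c (R / 2) ⊆ ball c R := ball_subset_ball (half_le_self hR.le)
  have hGd : DifferentiableOn ℂ G (ball c (R / 2)) :=
    (hcauchy.tendstoUniformlyOn_of_tendsto hG).tendstoLocallyUniformlyOn.differentiableOn
      (hFd.mono fun n hn => (hn.mono hsub).sub_const _) isOpen_ball
  have hball := ball_mem_nhds c (half_pos hR)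
  have hGa : AnalyticAt ℂ (fun z => G z + β c) c := (hGd.analyticAt hball).add analyticAt_const
  refine (harmonicAt_congr_nhds ?_).1 hGa.harmonicAt_re
  filter_upwards [hball] with z hz
  have hGβ : (G z).re = β z - β c :=
    tendsto_nhds_unique ((Complex.continuous_re.tendsto _).comp (hG z hz))
      ((hFβ.tendsto_at (hsub hz)).sub (hFβ.tendsto_at (mem_ball_self hR)))
  simp [hGβ]

theorem harmonicOnNhd_of_tendstoLocallyUniformlyOn {h : ℕ → ℂ → ℝ} {β : ℂ → ℝ} {Ω : Set ℂ}
    (hΩ : IsOpen Ω) (hh : ∀ᶠ n in atTop, HarmonicOnNhd (h n) Ω)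
    (hβ : TendstoLocallyUniformlyOn h β atTop Ω) : HarmonicOnNhd β Ω := by
  intro c hc
  obtain ⟨R, hR, hRΩ⟩ := nhds_basis_closedBall.mem_iff.1 (hΩ.mem_nhds hc)
  have hunif := (tendstoLocallyUniformlyOn_iff_forall_isCompact hΩ).1 hβ _ hRΩ
    (isCompact_closedBall c R)
  exact harmonicAt_of_tendstoUniformlyOn_ball hR
    (hh.mono fun n hn => hn.mono (ball_subset_closedBall.trans hRΩ))
    (hunif.mono ball_subset_closedBall)

end HarmonicLimits

section RadialContraction

variable {E X : Type*} [AddCommGroup E] [TopologicalSpace E] [IsTopologicalAddGroup E] [Module ℝ E]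
  [ContinuousSMul ℝ E] [TopologicalSpace X] {K : Set E} {c : E}

/-- The homotopy `(s, z) ↦ c + s (z - c)` contracting a set that is star-convex about `c` to
`c`. -/
def radialContraction (hK : StarConvex ℝ c K) : C(unitInterval × K, K) where
  toFun p := ⟨c + (p.1 : ℝ) • ((p.2 : E) - c),
    hK.add_smul_sub_mem p.2.2 p.1.2.1 p.1.2.2⟩

theorem mem_closure_of_forall_comp_radialContraction (hK : StarConvex ℝ c K)
    {F : C(K, X)} {S : Set C(K, X)}
    (h : ∀ s : unitInterval, s ≠ 1 → (F.comp (radialContraction hK)).curry s ∈ closure S) :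
    F ∈ closure S := by
  have hF : (F.comp (radialContraction hK)).curry 1 = F := by
    ext z
    simp [radialContraction]
  rw [← hF, ← closure_closure]
  exact map_mem_closure (ContinuousMap.continuous _) (dense_compl_singleton 1 1) h

end RadialContraction

section ContinuousConvergence

variable {X Y ι : Type*} [UniformSpace Y] {l : Filter ι} {p : ι → X → Y} {F : X → Y}

theorem tendstoLocallyUniformlyOn_iff_forall_tendsto_nhds [TopologicalSpace X] {Ω : Set X}
    (hΩ : IsOpen Ω) (hF : ContinuousOn F Ω) :
    TendstoLocallyUniformlyOn p F l Ω ↔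
      ∀ z ∈ Ω, Tendsto (fun q : ι × X => p q.1 q.2) (l ×ˢ 𝓝 z) (𝓝 (F z)) := by
  rw [hΩ.tendstoLocallyUniformlyOn_iff_forall_tendsto]
  refine forall₂_congr fun z hz => ?_
  have hFz : Tendsto (fun q : ι × X => F q.2) (l ×ˢ 𝓝 z) (𝓝 (F z)) :=
    (hF.continuousAt (hΩ.mem_nhds hz)).tendsto.comp tendsto_snd
  exact ⟨fun h => hFz.congr_uniformity h,
    fun h => (hFz.prodMk_nhds h).mono_right (nhds_le_uniformity _)⟩

theorem tendstoLocallyUniformlyOn_comp_left [TopologicalSpace X] {Z : Type*} [UniformSpace Z]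
    {Ω : Set X} {V : Set Y} {J : Y → Z} (hp : TendstoLocallyUniformlyOn p F l Ω) (hΩ : IsOpen Ω)
    (hF : ContinuousOn F Ω) (hV : IsOpen V) (hJ : ContinuousOn J V) (hFV : Set.MapsTo F Ω V) :
    TendstoLocallyUniformlyOn (fun n z => J (p n z)) (fun z => J (F z)) l Ω :=
  (tendstoLocallyUniformlyOn_iff_forall_tendsto_nhds hΩ (hJ.comp hF hFV)).2 fun z hz =>
    (hJ.continuousAt (hV.mem_nhds (hFV hz))).tendsto.comp
      ((tendstoLocallyUniformlyOn_iff_forall_tendsto_nhds hΩ hF).1 hp z hz)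

theorem exists_ball_mapsTo_and_eventually_mapsTo [PseudoMetricSpace X] {Ω : Set X} {V : Set Y}
    {c : X} (hp : TendstoLocallyUniformlyOn p F l Ω) (hΩ : IsOpen Ω) (hF : ContinuousOn F Ω)
    (hc : c ∈ Ω) (hV : V ∈ 𝓝 (F c)) :
    ∃ r > 0, Metric.ball c r ⊆ Ω ∧ Set.MapsTo F (Metric.ball c r) V ∧
      ∀ᶠ n in l, Set.MapsTo (p n) (Metric.ball c r) V := by
  obtain ⟨A, hA, B, hB, hAB⟩ := mem_prod_iff.1
    ((tendstoLocallyUniformlyOn_iff_forall_tendsto_nhds hΩ hF).1 hp c hc hV)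
  obtain ⟨r, hr, hball⟩ := Metric.mem_nhds_iff.1 <| inter_mem (inter_mem hB (hΩ.mem_nhds hc))
    ((hF.continuousAt (hΩ.mem_nhds hc)).preimage_mem_nhds hV)
  refine ⟨r, hr, fun z hz => (hball hz).1.2, fun z hz => (hball hz).2, ?_⟩
  filter_upwards [hA] with n hn z hz
  exact @hAB (n, z) ⟨hn, (hball hz).1.1⟩

end ContinuousConvergence

section NonnegRealPart

theorem eqOn_zero_of_re_nonneg {U : Set ℂ} {c : ℂ} {g : ℂ → ℂ} (hg : DifferentiableOn ℂ g U)
    (hU : IsOpen U) (hUc : IsPreconnected U) (hre : ∀ z ∈ U, 0 ≤ (g z).re) (hc : c ∈ U)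
    (hgc : g c = 0) : Set.EqOn g 0 U := by
  rcases (hg.analyticOnNhd hU).is_constant_or_isOpen hUc with ⟨w, hw⟩ | hopen
  · exact fun z hz => (hw z hz).trans ((hw c hc).symm.trans hgc)
  · have himage : g '' U ⊆ {w : ℂ | 0 ≤ w.re} := Set.image_subset_iff.2 hre
    have h0 : (0 : ℂ) ∈ interior {w : ℂ | 0 ≤ w.re} :=
      interior_maximal himage (hopen U subset_rfl hU) ⟨c, hc, hgc⟩
    rw [Complex.interior_setOfPred_le_re] at h0
    simp at h0

end NonnegRealPart

namespace CircleCompactification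

section Topology

theorem isometry_toDisc : Isometry toDisc := Isometry.of_dist_eq fun _ _ => rfl

theorem continuous_ofComplex : Continuous ofComplex := by
  rw [← isometry_toDisc.comp_continuous_iff]
  exact continuous_id.div (by fun_prop) fun z => Complex.ofReal_ne_zero.2 (by positivity)

theorem isometry_infinity : Isometry infinity := Isometry.of_dist_eq fun _ _ => rfl

theorem toDisc_ofComplex_exp_sub (w : ℂ) :
    toDisc (ofComplex (Complex.exp w)) - toDisc (infinity (Circle.exp w.im)) =
      -(Circle.exp w.im / ((1 + Real.exp w.re : ℝ) : ℂ)) := by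
  have hne : ((1 + Real.exp w.re : ℝ) : ℂ) ≠ 0 := Complex.ofReal_ne_zero.2 (by positivity)
  have hw : Complex.exp w = (Real.exp w.re : ℂ) * Circle.exp w.im := by
    rw [Circle.coe_exp, Complex.ofReal_exp, ← Complex.exp_add, Complex.re_add_im]
  rw [toDisc, toDisc, Complex.norm_exp, hw]
  field_simp
  push_cast
  ring

theorem dist_ofComplex_exp_infinity_le (w : ℂ) :
    dist (ofComplex (Complex.exp w)) (infinity (Circle.exp w.im)) ≤ Real.exp (-w.re) := by
  rw [dist_eq, toDisc_ofComplex_exp_sub, norm_neg, norm_div, Circle.norm_coe, Complex.norm_real,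
    Real.norm_of_nonneg (by positivity), Real.exp_neg, ← one_div]
  exact one_div_le_one_div_of_le (Real.exp_pos _) (by linarith)

end Topology

section Approximation

open InnerProductSpace

variable {L : Set ℂ} {z₀ : ℂ}

/-- A complex polynomial, as a continuous map from `L` to the compactified plane. -/
noncomputable def polynomialMap (L : Set ℂ) (P : Polynomial ℂ) : C(L, CircleCompactification) :=
  (⟨ofComplex, continuous_ofComplex⟩ : C(ℂ, CircleCompactification)).comp (P.toContinuousMapOn L)

variable [CompactSpace L]

theorem isUniformLimitOfPolynomials_iff_mem_closure {F : C(L, CircleCompactification)} :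
    IsUniformLimitOfPolynomials L F ↔ F ∈ closure (Set.range (polynomialMap L)) := by
  rw [mem_closure_iff_seq_limit]
  constructor
  · rintro ⟨P, hP⟩
    exact ⟨fun n => polynomialMap L (P n), fun n => Set.mem_range_self _,
      ContinuousMap.tendsto_iff_tendstoUniformly.2 hP⟩
  · rintro ⟨G, hG, hGF⟩
    choose P hP using hG
    obtain rfl : (fun n => polynomialMap L (P n)) = G := funext hP
    exact ⟨P, ContinuousMap.tendsto_iff_tendstoUniformly.1 hGF⟩

theorem ofComplex_comp_mem_closure (hL : StarConvex ℝ z₀ L) (hz₀ : z₀ ∈ L) {U : Set ℂ}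
    (hU : IsOpen U) (hLU : L ⊆ U) {g : ℂ → ℂ} (hg : DifferentiableOn ℂ g U)
    {F : C(L, CircleCompactification)} (hF : ∀ z : L, F z = ofComplex (g z)) :
    F ∈ closure (Set.range (polynomialMap L)) := by
  let G : C(L, ℂ) := ⟨fun z => g z, continuousOn_iff_continuous_domRestrict.1
    (hg.continuousOn.mono hLU)⟩
  let φ : C(ℂ, CircleCompactification) := ⟨ofComplex, continuous_ofComplex⟩
  obtain rfl : φ.comp G = F := ContinuousMap.ext fun z => (hF z).symm
  refine map_mem_closure φ.continuous_postcomp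
    (mem_closure_polynomialFunctions_of_starConvex hL hz₀ hU hLU hg (G := G) fun _ => rfl)
    fun _ ⟨P, _, hP⟩ => ⟨P, congrArg φ.comp hP⟩

theorem infinity_exp_im_polynomial_mem_closure (hL : StarConvex ℝ z₀ L) (hz₀ : z₀ ∈ L)
    (Q : Polynomial ℂ) {F : C(L, CircleCompactification)}
    (hF : ∀ z : L, F z = infinity (Circle.exp (Q.eval (z : ℂ)).im)) :
    F ∈ closure (Set.range (polynomialMap L)) := by
  -- `exp (Q + n)` has the argument of `exp Q`, while its modulus tends uniformly to infinity.
  let G : ℕ → C(L, CircleCompactification) := fun n =>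
    ⟨fun z => ofComplex (Complex.exp (Q.eval (z : ℂ) + n)), continuous_ofComplex.comp
      (Complex.continuous_exp.comp (by fun_prop))⟩
  have hG : ∀ n, G n ∈ closure (Set.range (polynomialMap L)) := fun n =>
    ofComplex_comp_mem_closure hL hz₀ isOpen_univ (Set.subset_univ L)
      (g := fun z => Complex.exp (Q.eval z + n))
      (Q.differentiable.add_const _).cexp.differentiableOn fun _ => rfl
  obtain ⟨m, hm⟩ := (isCompact_range (f := fun z : L => (Q.eval (z : ℂ)).re)
    (by fun_prop)).bddBelow
  have hdist : ∀ n (z : L), dist (F z) (G n z) ≤ Real.exp (-(m + n)) := fun n z => by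
    have hz := dist_ofComplex_exp_infinity_le (Q.eval (z : ℂ) + n)
    have hmz : m ≤ (Q.eval (z : ℂ)).re := hm (Set.mem_range_self z)
    simp only [Complex.add_re, Complex.add_im, Complex.natCast_re, Complex.natCast_im,
      add_zero] at hz
    rw [dist_comm, hF]
    exact hz.trans (Real.exp_le_exp.2 (by linarith))
  have hexp : Tendsto (fun n : ℕ => Real.exp (-(m + n))) atTop (𝓝 0) :=
    Real.tendsto_exp_neg_atTop_nhds_zero.comp
      (tendsto_atTop_add_const_left _ m tendsto_natCast_atTop_atTop)
  refine isClosed_closure.mem_of_tendsto (f := G) (b := atTop) ?_ (Eventually.of_forall hG)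
  rw [ContinuousMap.tendsto_iff_tendstoUniformly, Metric.tendstoUniformly_iff]
  intro ε hε
  filter_upwards [hexp.eventually_lt_const hε] with n hn z
  exact (hdist n z).trans_lt hn

theorem infinity_exp_comp_mem_closure (hL : StarConvex ℝ z₀ L) (hz₀ : z₀ ∈ L) {U : Set ℂ}
    (hU : IsOpen U) (hLU : L ⊆ U) {θ : ℂ → ℝ} (hθ : HarmonicOnNhd θ U)
    {F : C(L, CircleCompactification)} (hF : ∀ z : L, F z = infinity (Circle.exp (θ z))) :
    F ∈ closure (Set.range (polynomialMap L)) := by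
  let Θ : C(L, ℝ) := ⟨fun z => θ z, continuousOn_iff_continuous_domRestrict.1
    fun z hz => (hθ z (hLU hz)).1.continuousAt.continuousWithinAt⟩
  let φ : C(ℝ, CircleCompactification) :=
    ⟨fun t => infinity (Circle.exp t), isometry_infinity.continuous.comp Circle.exp.continuous⟩
  obtain rfl : φ.comp Θ = F := ContinuousMap.ext fun z => (hF z).symm
  rw [← closure_closure]
  refine map_mem_closure φ.continuous_postcomp
    (mem_closure_range_im_polynomial_of_starConvex hL hz₀ hU hLU hθ (Θ := Θ) fun _ => rfl) ?_
  rintro - ⟨Q, rfl⟩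
  exact infinity_exp_im_polynomial_mem_closure hL hz₀ Q fun _ => rfl

theorem IsFiniteType.isUniformLimitOfPolynomials {f : L → CircleCompactification}
    (hL : StrictStarConvex z₀ L) (hz₀ : z₀ ∈ L) (hf : IsFiniteType L f) :
    IsUniformLimitOfPolynomials L f := by
  obtain ⟨hfc, g, hg, hfg⟩ := hf
  have hstar := hL.starConvex
  refine isUniformLimitOfPolynomials_iff_mem_closure (F := ⟨f, hfc⟩).2 <|
    mem_closure_of_forall_comp_radialContraction hstar fun s hs => ?_
  have hmem : ∀ z ∈ L, z₀ + (s : ℝ) • (z - z₀) ∈ interior L := fun z hz =>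
    hL hz ⟨s.2.1, unitInterval.lt_one_iff_ne_one.2 hs⟩
  exact ofComplex_comp_mem_closure hstar hz₀
    (U := (fun z => z₀ + (s : ℝ) • (z - z₀)) ⁻¹' interior L)
    (isOpen_interior.preimage (by fun_prop)) hmem
    (g := fun z => g (z₀ + (s : ℝ) • (z - z₀))) (hg.comp (by fun_prop) fun z hz => hz)
    fun z => hfg _ (hmem z z.2)

theorem IsInfiniteType.isUniformLimitOfPolynomials {f : L → CircleCompactification}
    (hL : StrictStarConvex z₀ L) (hz₀ : z₀ ∈ L) (hf : IsInfiniteType L f) :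
    IsUniformLimitOfPolynomials L f := by
  obtain ⟨hfc, θ, -, hθ, hfθ⟩ := hf
  have hstar := hL.starConvex
  refine isUniformLimitOfPolynomials_iff_mem_closure (F := ⟨f, hfc⟩).2 <|
    mem_closure_of_forall_comp_radialContraction hstar fun s hs => ?_
  exact infinity_exp_comp_mem_closure hstar hz₀
    (U := (fun z => z₀ + (s : ℝ) • (z - z₀)) ⁻¹' interior L)
    (isOpen_interior.preimage (by fun_prop))
    (fun z hz => hL hz ⟨s.2.1, unitInterval.lt_one_iff_ne_one.2 hs⟩)
    (θ := fun z => θ (z₀ + (s : ℝ) • (z - z₀)))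
    (fun z hz => harmonicAt_comp_of_analyticAt (φ := fun z => z₀ + (s : ℝ) • (z - z₀))
      (hθ _ hz) (by fun_prop))
    fun z => hfθ _

end Approximation

section Charts

theorem range_ofComplex_eq_compl : Set.range ofComplex = (Set.range infinity)ᶜ := by
  ext (z | u) <;> simp

theorem isClosed_range_infinity : IsClosed (Set.range infinity) :=
  isometry_infinity.isClosedEmbedding.isClosed_range

theorem isOpen_range_ofComplex : IsOpen (Set.range ofComplex) := by
  rw [range_ofComplex_eq_compl]
  exact isClosed_range_infinity.isOpen_compl

theorem one_sub_norm_toDisc_ofComplex (z : ℂ) :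
    1 - ‖toDisc (ofComplex z)‖ = (1 + ‖z‖)⁻¹ := by
  rw [norm_toDisc_ofComplex]
  field_simp
  ring

theorem one_sub_norm_toDisc_ofComplex_pos (z : ℂ) : 0 < 1 - ‖toDisc (ofComplex z)‖ :=
  sub_pos.2 (norm_toDisc_ofComplex_lt_one z)

theorem toDisc_ofComplex_eq (z : ℂ) :
    toDisc (ofComplex z) = ((1 - ‖toDisc (ofComplex z)‖ : ℝ) : ℂ) * z := by
  rw [one_sub_norm_toDisc_ofComplex, toDisc, Complex.ofReal_inv, inv_mul_eq_div]

theorem norm_toDisc_le_one : ∀ x : CircleCompactification, ‖toDisc x‖ ≤ 1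
  | ofComplex z => (norm_toDisc_ofComplex_lt_one z).le
  | infinity u => (norm_toDisc_infinity u).le

/-- The chart of the compactification on the finite plane, with junk value `0` at infinity. -/
def toComplex : CircleCompactification → ℂ
  | ofComplex z => z
  | infinity _ => 0

theorem continuousOn_toComplex : ContinuousOn toComplex (Set.range ofComplex) := by
  have hpos : ∀ x ∈ Set.range ofComplex, ((1 - ‖toDisc x‖ : ℝ) : ℂ) ≠ 0 := by
    rintro - ⟨z, rfl⟩
    exact Complex.ofReal_ne_zero.2 (one_sub_norm_toDisc_ofComplex_pos z).ne'
  have hdisc : Continuous toDisc := isometry_toDisc.continuous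
  refine ContinuousOn.congr (f := fun x => toDisc x / ((1 - ‖toDisc x‖ : ℝ) : ℂ))
    (hdisc.continuousOn.div (by fun_prop) hpos) ?_
  rintro - ⟨z, rfl⟩
  rw [eq_div_iff (hpos _ ⟨z, rfl⟩), mul_comm]
  exact (toDisc_ofComplex_eq z).symm

/-- The extension of `z ↦ z⁻¹` by `0` to the points at infinity; it is continuous away from the
origin, where it has the junk value `0⁻¹ = 0`. -/
noncomputable def inv : CircleCompactification → ℂ
  | ofComplex z => z⁻¹
  | infinity _ => 0

theorem inv_eq_div : ∀ x : CircleCompactification, inv x = ((1 - ‖toDisc x‖ : ℝ) : ℂ) / toDisc x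
  | ofComplex z => by
    have hpos := Complex.ofReal_ne_zero.2 (one_sub_norm_toDisc_ofComplex_pos z).ne'
    exact ((congrArg (_ / ·) (toDisc_ofComplex_eq z)).trans (div_mul_cancel_left₀ hpos z)).symm
  | infinity u => by rw [norm_toDisc_infinity, sub_self, Complex.ofReal_zero, zero_div, inv]

/-- The points of the compactification whose argument differs by less than `π / 2` from that of
the direction `u`: an open half of the closed disc, seen through `toDisc`. -/
def halfDisc (u : Circle) : Set CircleCompactification :=
  {x | 0 < (toDisc x / u).re}

variable {u : Circle}

theorem isOpen_halfDisc : IsOpen (halfDisc u) :=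
  isOpen_lt continuous_const
    (Complex.continuous_re.comp (isometry_toDisc.continuous.div_const _))

theorem infinity_mem_halfDisc : infinity u ∈ halfDisc u := by
  simp [halfDisc, toDisc]

theorem toDisc_ne_zero_of_mem_halfDisc {x : CircleCompactification} (hx : x ∈ halfDisc u) :
    toDisc x ≠ 0 := by
  rintro h
  simp [halfDisc, h] at hx

theorem ofComplex_mem_halfDisc_iff {z : ℂ} : ofComplex z ∈ halfDisc u ↔ 0 < (z / u).re := by
  rw [halfDisc, Set.mem_ofPred_eq, toDisc_ofComplex_eq, mul_div_assoc, Complex.re_ofReal_mul]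
  exact mul_pos_iff_of_pos_left (one_sub_norm_toDisc_ofComplex_pos z)

theorem continuousOn_inv_halfDisc : ContinuousOn inv (halfDisc u) := by
  have hdisc : Continuous toDisc := isometry_toDisc.continuous
  rw [funext inv_eq_div]
  exact ContinuousOn.div (by fun_prop) hdisc.continuousOn
    fun x hx => toDisc_ne_zero_of_mem_halfDisc hx

theorem re_mul_inv_nonneg_of_mem_halfDisc {x : CircleCompactification} (hx : x ∈ halfDisc u) :
    0 ≤ (u * inv x).re := by
  have h : (u : ℂ) * inv x = ((1 - ‖toDisc x‖ : ℝ) : ℂ) * (toDisc x / u)⁻¹ := by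
    rw [inv_eq_div, inv_div]
    ring
  rw [h, Complex.re_ofReal_mul, Complex.inv_re]
  exact mul_nonneg (sub_nonneg.2 (norm_toDisc_le_one x))
    (div_nonneg (le_of_lt hx) (Complex.normSq_nonneg _))

theorem mem_range_infinity_of_inv_eq_zero {x : CircleCompactification} (hx : x ∈ halfDisc u)
    (h : inv x = 0) : x ∈ Set.range infinity := by
  cases x with
  | ofComplex z =>
    have hz : z = 0 := inv_eq_zero.1 h
    simp [ofComplex_mem_halfDisc_iff, hz] at hx
  | infinity v => exact Set.mem_range_self v

/-- The argument in `(-π, π]` of a point of the compactification relative to the direction `u`. -/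
noncomputable def argFrom (u : Circle) (x : CircleCompactification) : ℝ :=
  (toDisc x / u).arg

theorem continuousOn_argFrom : ContinuousOn (argFrom u) (halfDisc u) := fun _ hx =>
  ((Complex.continuousAt_arg (Or.inl hx)).comp (f := fun x => toDisc x / u)
    (isometry_toDisc.continuous.div_const _).continuousAt).continuousWithinAt

theorem argFrom_ofComplex (z : ℂ) : argFrom u (ofComplex z) = (z / u).arg := by
  rw [argFrom, toDisc_ofComplex_eq, mul_div_assoc,
    Complex.arg_real_mul _ (one_sub_norm_toDisc_ofComplex_pos z)]

theorem argFrom_infinity_exp {s t : ℝ} (h : |s - t| < Real.pi) :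
    argFrom (Circle.exp t) (infinity (Circle.exp s)) = s - t := by
  rw [argFrom, toDisc, ← Circle.coe_div, ← Circle.exp_sub]
  exact Circle.arg_exp (abs_lt.1 h).1 (abs_lt.1 h).2.le

end Charts

section LimitsOfHolomorphicFunctions

open InnerProductSpace

variable {Ω : Set ℂ} {p : ℕ → ℂ → ℂ} {F : ℂ → CircleCompactification}

theorem differentiableOn_toComplex_comp (hΩ : IsOpen Ω) (hp : ∀ n, DifferentiableOn ℂ (p n) Ω)
    (hF : ContinuousOn F Ω)
    (hpF : TendstoLocallyUniformlyOn (fun n z => ofComplex (p n z)) F atTop Ω)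
    (hfin : Set.MapsTo F Ω (Set.range ofComplex)) :
    DifferentiableOn ℂ (fun z => toComplex (F z)) Ω :=
  (tendstoLocallyUniformlyOn_comp_left hpF hΩ hF isOpen_range_ofComplex continuousOn_toComplex
    hfin).differentiableOn (Eventually.of_forall hp) hΩ

theorem eventually_mem_range_infinity (hΩ : IsOpen Ω) (hp : ∀ n, DifferentiableOn ℂ (p n) Ω)
    (hF : ContinuousOn F Ω)
    (hpF : TendstoLocallyUniformlyOn (fun n z => ofComplex (p n z)) F atTop Ω)
    {c : ℂ} (hc : c ∈ Ω) (hFc : F c ∈ Set.range infinity) :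
    ∀ᶠ z in 𝓝 c, F z ∈ Set.range infinity := by
  obtain ⟨u, hu⟩ := hFc
  obtain ⟨r, hr, hrΩ, hFr, hpr⟩ := exists_ball_mapsTo_and_eventually_mapsTo hpF hΩ hF hc
    (hu ▸ isOpen_halfDisc.mem_nhds infinity_mem_halfDisc)
  -- `u / F` is a holomorphic function with values in the closed right half-plane and a zero at `c`.
  have hlim := tendstoLocallyUniformlyOn_comp_left (hpF.mono hrΩ) Metric.isOpen_ball
    (hF.mono hrΩ) isOpen_halfDisc (continuousOn_const.mul continuousOn_inv_halfDisc) hFr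
    (J := fun x => (u : ℂ) * inv x)
  have hhol : DifferentiableOn ℂ (fun z => (u : ℂ) * inv (F z)) (Metric.ball c r) := by
    refine hlim.differentiableOn ?_ Metric.isOpen_ball
    filter_upwards [hpr] with n hn
    refine (((hp n).mono hrΩ).inv fun z hz h0 => ?_).const_mul (u : ℂ)
    have hz' := ofComplex_mem_halfDisc_iff.1 (hn hz)
    simp [h0] at hz'
  have hzero : Set.EqOn (fun z => (u : ℂ) * inv (F z)) 0 (Metric.ball c r) :=
    eqOn_zero_of_re_nonneg hhol Metric.isOpen_ball (convex_ball c r).isPreconnected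
      (fun z hz => re_mul_inv_nonneg_of_mem_halfDisc (hFr hz)) (Metric.mem_ball_self hr)
      (by simp [← hu, inv])
  filter_upwards [Metric.ball_mem_nhds c hr] with z hz
  exact mem_range_infinity_of_inv_eq_zero (hFr hz)
    ((mul_eq_zero.1 (hzero hz)).resolve_left (Circle.coe_ne_zero u))

theorem mapsTo_range_ofComplex_or_mapsTo_range_infinity (hΩ : IsOpen Ω) (hΩc : IsPreconnected Ω)
    (hp : ∀ n, DifferentiableOn ℂ (p n) Ω) (hF : ContinuousOn F Ω)
    (hpF : TendstoLocallyUniformlyOn (fun n z => ofComplex (p n z)) F atTop Ω) :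
    Set.MapsTo F Ω (Set.range ofComplex) ∨ Set.MapsTo F Ω (Set.range infinity) := by
  have hfin : IsOpen (Ω ∩ F ⁻¹' Set.range ofComplex) :=
    hF.isOpen_inter_preimage hΩ isOpen_range_ofComplex
  have hinf : IsOpen (Ω ∩ F ⁻¹' Set.range infinity) := isOpen_iff_mem_nhds.2 fun z hz =>
    inter_mem (hΩ.mem_nhds hz.1) (eventually_mem_range_infinity hΩ hp hF hpF hz.1 hz.2)
  have hcover : Ω ⊆ Ω ∩ F ⁻¹' Set.range ofComplex ∪ Ω ∩ F ⁻¹' Set.range infinity := by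
    rw [range_ofComplex_eq_compl, ← Set.inter_union_distrib_left, Set.preimage_compl,
      Set.compl_union_self, Set.inter_univ]
  have hdisj : Ω ∩ (Ω ∩ F ⁻¹' Set.range ofComplex ∩ (Ω ∩ F ⁻¹' Set.range infinity)) = ∅ := by
    rw [range_ofComplex_eq_compl]
    exact Set.eq_empty_of_forall_notMem fun z hz => hz.2.1.2 hz.2.2.2
  exact (isPreconnected_iff_subset_of_disjoint.1 hΩc _ _ hfin hinf hcover hdisj).imp
    (fun h z hz => (h hz).2) fun h z hz => (h hz).2

theorem harmonicOnNhd_of_eq_infinity_exp (hΩ : IsOpen Ω) (hp : ∀ n, DifferentiableOn ℂ (p n) Ω)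
    (hF : ContinuousOn F Ω)
    (hpF : TendstoLocallyUniformlyOn (fun n z => ofComplex (p n z)) F atTop Ω)
    {θ : ℂ → ℝ} (hθ : ContinuousOn θ Ω) (hFθ : ∀ z ∈ Ω, F z = infinity (Circle.exp (θ z))) :
    HarmonicOnNhd θ Ω := by
  intro c hc
  let u := Circle.exp (θ c)
  let Ω' := Ω ∩ θ ⁻¹' Metric.ball (θ c) Real.pi
  have hΩ' : IsOpen Ω' := hθ.isOpen_inter_preimage hΩ Metric.isOpen_ball
  have hcΩ' : c ∈ Ω' := ⟨hc, Metric.mem_ball_self Real.pi_pos⟩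
  have hΩ'Ω : Ω' ⊆ Ω := Set.inter_subset_left
  obtain ⟨r, hr, hrΩ', hFr, hpr⟩ := exists_ball_mapsTo_and_eventually_mapsTo (hpF.mono hΩ'Ω) hΩ'
    (hF.mono hΩ'Ω) hcΩ' (hFθ c hc ▸ isOpen_halfDisc.mem_nhds infinity_mem_halfDisc)
  have hrΩ := hrΩ'.trans hΩ'Ω
  have hlim := tendstoLocallyUniformlyOn_comp_left (hpF.mono hrΩ) Metric.isOpen_ball
    (hF.mono hrΩ) isOpen_halfDisc (continuousOn_argFrom (u := u)) hFr
  have hharm : HarmonicOnNhd (fun z => argFrom u (F z)) (Metric.ball c r) := by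
    refine harmonicOnNhd_of_tendstoLocallyUniformlyOn Metric.isOpen_ball ?_ hlim
    filter_upwards [hpr] with n hn z hz
    have hpz : AnalyticAt ℂ (fun w => p n w / u) z :=
      ((hp n).analyticAt (hΩ.mem_nhds (hrΩ hz))).div_const
    simp only [argFrom_ofComplex, ← Complex.log_im]
    exact (hpz.clog (Or.inl (ofComplex_mem_halfDisc_iff.1 (hn hz)))).harmonicAt_im
  have harg : θ =ᶠ[𝓝 c] (fun z => argFrom u (F z)) + fun _ => θ c := by
    filter_upwards [Metric.ball_mem_nhds c hr] with z hz
    rw [Pi.add_apply, hFθ z (hrΩ hz), argFrom_infinity_exp (hrΩ' hz).2, sub_add_cancel]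
  exact (harmonicAt_congr_nhds harg).2
    ((hharm c (Metric.mem_ball_self hr)).add (harmonicAt_const _))

end LimitsOfHolomorphicFunctions

section PolynomialLimits

open InnerProductSpace

variable {L : Set ℂ}

theorem exists_lift_of_forall_mem_range_infinity [ContractibleSpace L]
    {f : L → CircleCompactification} (hf : Continuous f) (hinf : ∀ z, f z ∈ Set.range infinity) :
    ∃ θ : ℂ → ℝ, ContinuousOn θ L ∧ ∀ z : L, f z = infinity (Circle.exp (θ z)) := by
  choose v hv using hinf
  obtain rfl : infinity ∘ v = f := funext hv
  obtain ⟨θ, hθ⟩ := exists_continuousMap_lift Circle.isCoveringMap_exp Circle.exp_surjective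
    ⟨v, isometry_infinity.comp_continuous_iff.1 hf⟩
  have hext : L.domRestrict (Function.extend Subtype.val θ 0) = θ :=
    funext (Subtype.val_injective.extend_apply θ 0)
  refine ⟨Function.extend Subtype.val θ 0, ?_, fun z => ?_⟩
  · rw [continuousOn_iff_continuous_domRestrict, hext]
    exact θ.continuous
  · rw [Subtype.val_injective.extend_apply]
    exact congrArg infinity (DFunLike.congr_fun hθ z).symm

theorem IsUniformLimitOfPolynomials.isFiniteType_or_isInfiniteType [ContractibleSpace L]
    {f : L → CircleCompactification} (hL : L ⊆ closure (interior L))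
    (hLc : IsPreconnected (interior L)) (hf : IsUniformLimitOfPolynomials L f) :
    IsFiniteType L f ∨ IsInfiniteType L f := by
  obtain ⟨P, hP⟩ := hf
  have hfc : Continuous f := hP.continuous <| Frequently.of_forall fun n =>
    continuous_ofComplex.comp ((P n).continuous.comp continuous_subtype_val)
  let F : ℂ → CircleCompactification := Function.extend Subtype.val f fun _ => ofComplex 0
  have hFf : ∀ z : L, F z = f z := Subtype.val_injective.extend_apply f _
  have hFc : ContinuousOn F L :=
    continuousOn_iff_continuous_domRestrict.2 (hfc.congr fun z => (hFf z).symm)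
  have hPF : TendstoUniformlyOn (fun n z => ofComplex ((P n).eval z)) F atTop L :=
    tendstoUniformlyOn_iff_tendstoUniformly_comp_coe.2 ((funext hFf : F ∘ Subtype.val = f) ▸ hP)
  have hPΩ := (hPF.mono interior_subset).tendstoLocallyUniformlyOn
  have hPd : ∀ n, DifferentiableOn ℂ (fun z => (P n).eval z) (interior L) :=
    fun n => (P n).differentiable.differentiableOn
  have hFΩ : ContinuousOn F (interior L) := hFc.mono interior_subset
  refine (mapsTo_range_ofComplex_or_mapsTo_range_infinity isOpen_interior hLc hPd hFΩ hPΩ).imp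
    (fun hfin => ⟨hfc, _, differentiableOn_toComplex_comp isOpen_interior hPd hFΩ hPΩ hfin, ?_⟩)
    fun hinf => ?_
  · intro z hz
    obtain ⟨w, hw⟩ := hfin hz
    rw [← hFf, ← hw, toComplex]
  · have hinfL : ∀ z : L, f z ∈ Set.range infinity := fun z => by
      rw [← hFf, ← isClosed_range_infinity.closure_eq]
      exact ((hFc z z.2).mono interior_subset).mem_closure (hL z.2) hinf
    obtain ⟨θ, hθ, hfθ⟩ := exists_lift_of_forall_mem_range_infinity hfc hinfL
    exact ⟨hfc, θ, hθ, harmonicOnNhd_of_eq_infinity_exp isOpen_interior hPd hFΩ hPΩ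
      (hθ.mono interior_subset) fun z hz => (hFf ⟨z, interior_subset hz⟩).trans (hfθ _), hfθ⟩

end PolynomialLimits

end CircleCompactification

theorem proposition6p1 (L : Set ℂ) (hL : IsCompact L) (z₀ : ℂ) (hz₀ : z₀ ∈ interior L)
    (hstar : ∀ ζ ∈ frontier L, segment ℝ z₀ ζ \ {ζ} ⊆ interior L)
    (f : L → CircleCompactification) :
    CircleCompactification.IsUniformLimitOfPolynomials L f ↔
      CircleCompactification.IsFiniteType L f ∨ CircleCompactification.IsInfiniteType L f := by
  have := isCompact_iff_compactSpace.1 hL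
  have h := strictStarConvex_of_frontier hL.isBounded hz₀ hstar
  have hz₀L := interior_subset hz₀
  have := h.starConvex.contractibleSpace ⟨z₀, hz₀L⟩
  have hconn := (h.interior.starConvex.isPathConnected hz₀).isConnected.isPreconnected
  constructor
  · exact fun hf => hf.isFiniteType_or_isInfiniteType h.subset_closure_interior hconn
  · rintro (hf | hf)
    · exact hf.isUniformLimitOfPolynomials h hz₀L
    · exact hf.isUniformLimitOfPolynomials h hz₀L
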